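/- Let $n\ge 1$, $\mathbb N=\{1,2,\dots\}$, $\mathbb R_+=[0,\infty)$, and let $\lambda_n$ be Lebesgue measure. For a sequence $\omega=(\boldsymbol\omega_j)_{j\ge1}$ of points $\boldsymbol\omega_j=(\omega_{j,1},\dots,\omega_{j,n})$ of $[0,1]^n$ and $N\in\mathbb N$, let $$D_N(\omega)=\sup_R\left|\frac{\#\{1\le j\le N:\boldsymbol\omega_j\in R\}}{N}-\lambda_n(R)\right|,$$ where the supremum is over all rectangles $R=\prod_{i=1}^n[a_i,b_i)$ with $0\le a_i<b_i\le 1$ for every $i$. Let $\mathcal N=(N_i)_{i\ge1}$ be a strictly increasing sequence of positive integers and let $v:\mathbb N\to\mathbb R_+$ be non-increasing with $v(N)\to0$ as $N\to\infty$. Assume that $\omega$ is an $(\mathcal N,v)$-discrepancy satisfying sequence, that is, $$D_{N_i}(\omega)<v(N_i)\quad(i\in\mathbb N)\qquad\text{and}\qquad\limsup_{i\to\infty}N_{i-1}\,v(N_i)<1 .$$ Let $\Psi=(\psi_1,\dots,\psi_n)$ be an $n$-tuple of non-increasing functions $\psi_i:\mathbb N\to\mathbb R_+$, and put $$W_\omega(\Psi)=\{\mathbf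 x\in[0,1]^n:\ |x_i-\omega_{j,i}|<\psi_i(j)\ (1\le i\le n)\ \text{ for infinitely many } j\in\mathbb N\}.$$ For $0<c<1$, call a function $f:\mathbb N\to\mathbb R_+$ $c$-regular along $\mathcal N$ if $f(N_{i+1})\le c\,f(N_i)$ for all sufficiently large $i$. Suppose that for some $0<c<1$ either every $\psi_i$ $(1\le i\le n)$ is $c$-regular along $\mathcal N$, or $v$ is $c$-regular along $\mathcal N$. Suppose also that there are $\tau_1,\dots,\tau_n>0$ with $\sum_{j=1}^n\tau_j=1$ such that, for every sufficiently large $N\in\mathbb N$, $$\psi_j(N)\le v(N)^{\tau_j}\qquad(1\le j\le n).$$ Then $$\lambda_n(W_\omega(\Psi))=1\quad\text{if}\quad\sum_{j=1}^\infty v(N_j)^{-1}\prod_{i=1}^n\psi_i(N_j)=\infty .$$ -/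

import Mathlib

open MeasureTheory Filter Topology

/-- The half-open rectangle `[a₁, b₁) × ⋯ × [aₙ, bₙ)`. -/
def rectangle {n : ℕ} (a b : Fin n → ℝ) : Set (Fin n → ℝ) :=
  {x | ∀ i, a i ≤ x i ∧ x i < b i}

/-- The counting function `A(R; N, ω) = #{1 ≤ j ≤ N : ω_j ∈ R}`. Sequences are indexed by `j ≥ 1`;
the value `ω 0` is never used. -/
noncomputable def countIn {n : ℕ} (R : Set (Fin n → ℝ)) (N : ℕ) (ω : ℕ → Fin n → ℝ) : ℕ :=
  {j : ℕ | 1 ≤ j ∧ j ≤ N ∧ ω j ∈ R}.ncard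

/-- The discrepancy `D_N(ω)`: the supremum of `|A(R; N, ω) / N - λₙ(R)|` over all nondegenerate
half-open rectangles `R ⊆ [0,1]ⁿ`. For `N ≥ 1` all these numbers lie in `[0, 1]`. -/
noncomputable def discrepancy {n : ℕ} (ω : ℕ → Fin n → ℝ) (N : ℕ) : ℝ :=
  sSup {d : ℝ | ∃ a b : Fin n → ℝ,
    (∀ i, 0 ≤ a i ∧ a i < b i ∧ b i ≤ 1) ∧
    d = |(countIn (rectangle a b) N ω : ℝ) / (N : ℝ) - (volume (rectangle a b)).toReal|}

/-- `ω` is an `(𝒩, v)`-discrepancy satisfying sequence in `[0,1]ⁿ`. The increasing sequence of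
positive integers `N₁ < N₂ < ⋯` is enumerated from `0`, so that `𝒩 i` is `N_{i+1}`; the function
`v` is considered at positive integers only. The upper limit is taken in the extended reals. -/
structure IsDiscrepancySatisfying {n : ℕ} (𝒩 : ℕ → ℕ) (v : ℕ → ℝ) (ω : ℕ → Fin n → ℝ) :
    Prop where
  mem_cube : ∀ j, 1 ≤ j → ∀ i, 0 ≤ ω j i ∧ ω j i ≤ 1
  index_pos : ∀ i, 1 ≤ 𝒩 i
  index_strictMono : StrictMono 𝒩
  nonneg : ∀ N, 1 ≤ N → 0 ≤ v N
  antitone : AntitoneOn v (Set.Ici 1)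
  tendsto_zero : Tendsto v atTop (𝓝 0)
  discrepancy_lt : ∀ i, discrepancy ω (𝒩 i) < v (𝒩 i)
  limsup_lt : limsup (fun i : ℕ => (((𝒩 i : ℝ) * v (𝒩 (i + 1)) : ℝ) : EReal)) atTop < 1

/-- `f` is `c`-regular along `𝒩`: `0 < c < 1` and `f(N_{i+1}) ≤ c f(N_i)` for all large `i`. -/
def IsRegularAlong (c : ℝ) (𝒩 : ℕ → ℕ) (f : ℕ → ℝ) : Prop :=
  0 < c ∧ c < 1 ∧ ∀ᶠ i in atTop, f (𝒩 (i + 1)) ≤ c * f (𝒩 i)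

/-- The set `W_ω(Ψ)` of the points `x ∈ [0,1]ⁿ` such that `|x_i - ω_{j,i}| < ψ_i(j)` for all `i`
holds for infinitely many `j ≥ 1`. -/
def approxSet {n : ℕ} (ω : ℕ → Fin n → ℝ) (ψ : Fin n → ℕ → ℝ) : Set (Fin n → ℝ) :=
  {x | (∀ i, 0 ≤ x i ∧ x i ≤ 1) ∧ {j : ℕ | 1 ≤ j ∧ ∀ i, |x i - ω j i| < ψ i j}.Infinite}

/-! It suffices that each tail union of boxes has full measure in the unit cube. By Lebesgue density
this follows once every tail union fills a proportion `κ` of every small cube, with `κ` independent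
of the cube and of the tail.

Fix a cube of side `2r` and write `V = v(N_{i+1})`. A grid with sides `V ^ τ k` has cells of volume
`V`, more than the discrepancy at `N_{i+1}`, so every full cell holds a point of index at most
`N_{i+1}`. The first `N_i` points occupy at most `N_i ((2r)^n + D)` cells, `D` being the discrepancy
at `N_i`. Since `N_i V ≤ θ < 1` eventually, a fixed proportion of the cells holds a point of index
in `(N_i, N_{i+1}]`; choose one in each (`eventually_exists_well_distributed`).

Put boxes with half sides `ψ k (N_{i+1})` around the chosen points. Up to constants, block `i` has
total volume `(2r)^n φ i`, where `φ i` is a term of the divergent series. Grid counting bounds the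
overlap of blocks `i ≤ l` by a multiple of `(2r)^n φ l (φ i + ρ ^ (l - i))`
(`sum_sum_volume_inter_le`). The geometric term comes from the decay of `v` along the sequence: the
discrepancy of `N_i` points is at least `1/N_i`, so `v(N_{i+1}) ≤ θ / N_i ≤ θ v(N_i)`. Hence the
second moment is of the order of the square of the first as soon as `∑ φ i ≥ 1`, and the Chung–Erdős
inequality gives `κ` (`exists_le_volume_tailSet_inter`). -/

variable {n : ℕ}

/-! ### Second moments and Lebesgue density -/

/-- The Chung–Erdős inequality for finitely many events. -/
theorem sq_sum_measureReal_le {α ι : Type*} [MeasurableSpace α] (μ : Measure α) (F : Finset ι)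
    (E : ι → Set α) (hE : ∀ i, MeasurableSet (E i)) (hfin : ∀ i, μ (E i) ≠ ⊤) :
    (∑ i ∈ F, μ.real (E i)) ^ 2 ≤
      μ.real (⋃ i ∈ F, E i) * ∑ i ∈ F, ∑ j ∈ F, μ.real (E i ∩ E j) := by
  set U : Set α := ⋃ i ∈ F, E i with hU
  have hUm : MeasurableSet U := F.measurableSet_biUnion fun i _ => hE i
  have hUfin : μ U ≠ ⊤ := by
    refine ((measure_biUnion_finset_le F E).trans_lt ?_).ne
    exact ENNReal.sum_lt_top.2 fun i _ => (hfin i).lt_top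
  have hint : ∀ s : Set α, MeasurableSet s → μ s ≠ ⊤ →
      Integrable (s.indicator (fun _ => (1 : ℝ))) μ := fun s hs hf =>
    (integrable_indicator_iff hs).2 (integrableOn_const hf)
  have hval : ∀ s : Set α, MeasurableSet s → ∫ x, s.indicator (fun _ => (1 : ℝ)) x ∂μ = μ.real s :=
    fun s hs => by rw [integral_indicator_const _ hs]; simp
  have hcap : ∀ i j, μ (E i ∩ E j) ≠ ⊤ := fun i j => measure_ne_top_of_subset
    Set.inter_subset_left (hfin i)
  -- This quadratic in `t` is the integral of `(∑ 1_{E i} - t 1_U) ^ 2`; its discriminant is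
  -- therefore nonpositive, which is the claim.
  have key : ∀ t : ℝ, 0 ≤ μ.real U * (t * t) + (-2 * ∑ i ∈ F, μ.real (E i)) * t +
      ∑ i ∈ F, ∑ j ∈ F, μ.real (E i ∩ E j) := by
    intro t
    have hpt : ∀ x, (∑ i ∈ F, (E i).indicator (fun _ => (1 : ℝ)) x -
        t * U.indicator (fun _ => (1 : ℝ)) x) ^ 2 =
        U.indicator (fun _ => (1 : ℝ)) x * (t * t) +
        (-2 * t) * (∑ i ∈ F, (E i).indicator (fun _ => (1 : ℝ)) x) +
        ∑ i ∈ F, ∑ j ∈ F, (E i ∩ E j).indicator (fun _ => (1 : ℝ)) x := by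
      intro x
      have h1 : ∑ i ∈ F, ∑ j ∈ F, (E i ∩ E j).indicator (fun _ => (1 : ℝ)) x =
          (∑ i ∈ F, (E i).indicator (fun _ => (1 : ℝ)) x) ^ 2 := by
        rw [sq, Finset.sum_mul_sum]
        refine Finset.sum_congr rfl fun i _ => Finset.sum_congr rfl fun j _ => ?_
        by_cases hi : x ∈ E i <;> by_cases hj : x ∈ E j <;> simp [hi, hj]
      rw [h1]
      by_cases hx : x ∈ U
      · simp only [Set.indicator_of_mem hx]; ring
      · have : ∑ i ∈ F, (E i).indicator (fun _ => (1 : ℝ)) x = 0 := by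
          refine Finset.sum_eq_zero fun i hi => Set.indicator_of_notMem (fun hxi => hx ?_) _
          exact Set.mem_biUnion hi hxi
        simp [this, Set.indicator_of_notMem hx]
    have h0 : 0 ≤ ∫ x, (∑ i ∈ F, (E i).indicator (fun _ => (1 : ℝ)) x -
        t * U.indicator (fun _ => (1 : ℝ)) x) ^ 2 ∂μ := integral_nonneg fun x => sq_nonneg _
    simp only [hpt] at h0
    have i1 : Integrable (fun x => U.indicator (fun _ => (1 : ℝ)) x * (t * t)) μ :=
      (hint U hUm hUfin).mul_const _
    have i2 : Integrable (fun x => (-2 * t) *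
        (∑ i ∈ F, (E i).indicator (fun _ => (1 : ℝ)) x)) μ :=
      (integrable_finsetSum F fun i _ => hint _ (hE i) (hfin i)).const_mul _
    have i3 : Integrable (fun x => ∑ i ∈ F, ∑ j ∈ F,
        (E i ∩ E j).indicator (fun _ => (1 : ℝ)) x) μ :=
      integrable_finsetSum F fun i _ => integrable_finsetSum F fun j _ =>
        hint _ ((hE i).inter (hE j)) (hcap i j)
    have i12 : Integrable (fun x => U.indicator (fun _ => (1 : ℝ)) x * (t * t) + (-2 * t) *
        (∑ i ∈ F, (E i).indicator (fun _ => (1 : ℝ)) x)) μ := i1.add i2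
    rw [integral_add i12 i3, integral_add i1 i2, integral_mul_const, hval U hUm,
      integral_const_mul, integral_finsetSum F fun i _ => hint _ (hE i) (hfin i),
      integral_finsetSum F fun i _ => integrable_finsetSum F fun j _ =>
        hint _ ((hE i).inter (hE j)) (hcap i j)] at h0
    have e1 : ∀ i, ∫ x, (E i).indicator (fun _ => (1 : ℝ)) x ∂μ = μ.real (E i) :=
      fun i => hval _ (hE i)
    have e2 : ∀ i, ∫ x, ∑ j ∈ F, (E i ∩ E j).indicator (fun _ => (1 : ℝ)) x ∂μ =
        ∑ j ∈ F, μ.real (E i ∩ E j) := fun i => by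
      rw [integral_finsetSum F fun j _ => hint _ ((hE i).inter (hE j)) (hcap i j)]
      exact Finset.sum_congr rfl fun j _ => hval _ ((hE i).inter (hE j))
    simp only [e1, e2] at h0
    linarith
  have := discrim_le_zero key
  rw [discrim] at this
  nlinarith

/-- A measurable set that fills a fixed proportion of all small balls centred in an open set has
full measure in that set. -/
theorem measure_diff_eq_zero_of_density {α : Type*} [PseudoMetricSpace α] [MeasurableSpace α]
    [SecondCountableTopology α] [BorelSpace α] (μ : Measure α) [IsLocallyFiniteMeasure μ]
    [IsUnifLocDoublingMeasure μ] [ProperSpace α] [μ.IsOpenPosMeasure] {A O : Set α}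
    (hA : MeasurableSet A) (hO : MeasurableSet O) {κ : ℝ} (hκ : 0 < κ)
    (h : ∀ x ∈ O, ∀ᶠ r in 𝓝[>] (0 : ℝ),
      κ * μ.real (Metric.closedBall x r) ≤ μ.real (A ∩ Metric.closedBall x r)) :
    μ (O \ A) = 0 := by
  have hae := IsUnifLocDoublingMeasure.ae_tendsto_measure_inter_div μ (O \ A) 1
  have hae' : ∀ᵐ x ∂μ.restrict (O \ A), False := by
    filter_upwards [hae, ae_restrict_mem (hO.diff hA)] with x hx hxS
    have ht := hx (fun _ : ℝ => x) (fun r : ℝ => r) (l := 𝓝[>] 0) tendsto_id (by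
      filter_upwards [self_mem_nhdsWithin] with r hr
      exact Metric.mem_closedBall_self (by simpa using le_of_lt hr))
    have ht' := (ENNReal.tendsto_toReal ENNReal.one_ne_top).comp ht
    -- Almost every point of `O \ A` is a density point of it, yet `A` takes the proportion `κ` of
    -- each small ball there.
    have hle : (ENNReal.toReal 1) ≤ 1 - κ := by
      refine le_of_tendsto ht' ?_
      filter_upwards [h x hxS.1, self_mem_nhdsWithin] with r hr hr0
      have hb : μ (Metric.closedBall x r) ≠ ⊤ := (isCompact_closedBall x r).measure_ne_top
      have hpos : 0 < μ.real (Metric.closedBall x r) :=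
        ENNReal.toReal_pos (Metric.measure_closedBall_pos μ x hr0).ne' hb
      simp only [Function.comp, ENNReal.toReal_div]
      change μ.real _ / μ.real _ ≤ _
      rw [div_le_iff₀ hpos]
      have hsplit := measureReal_inter_add_sdiff (μ := μ) (s := Metric.closedBall x r) hA hb
      have hmono : μ.real (O \ A ∩ Metric.closedBall x r) ≤ μ.real (Metric.closedBall x r \ A) :=
        measureReal_mono (fun y hy => ⟨hy.2, hy.1.2⟩)
          (measure_ne_top_of_subset Set.sdiff_subset hb)
      rw [Set.inter_comm] at hsplit
      linarith
    simp at hle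
    linarith
  rw [ae_iff] at hae'
  simpa using hae'

/-! ### Points in rectangles -/

theorem rectangle_eq_pi (a b : Fin n → ℝ) :
    rectangle a b = Set.pi Set.univ fun i => Set.Ico (a i) (b i) := by
  ext x; simp [rectangle]

theorem volume_rectangle_toReal {a b : Fin n → ℝ} (h : ∀ i, a i ≤ b i) :
    (volume (rectangle a b)).toReal = ∏ i, (b i - a i) := by
  rw [rectangle_eq_pi, Real.volume_pi_Ico_toReal h]

theorem finite_setOf_countIn (R : Set (Fin n → ℝ)) (N : ℕ) (ω : ℕ → Fin n → ℝ) :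
    {j : ℕ | 1 ≤ j ∧ j ≤ N ∧ ω j ∈ R}.Finite :=
  (Set.finite_Icc 1 N).subset fun _ hj => ⟨hj.1, hj.2.1⟩

theorem countIn_le (R : Set (Fin n → ℝ)) (N : ℕ) (ω : ℕ → Fin n → ℝ) : countIn R N ω ≤ N := by
  have h : countIn R N ω ≤ (Set.Icc 1 N).ncard :=
    Set.ncard_le_ncard (fun _ hj => ⟨hj.1, hj.2.1⟩) (Set.finite_Icc 1 N)
  simpa [← Finset.coe_Icc, Set.ncard_coe_finset] using h

theorem abs_countIn_div_sub_volume_le_discrepancy (ω : ℕ → Fin n → ℝ) (N : ℕ) {a b : Fin n → ℝ}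
    (h : ∀ i, 0 ≤ a i ∧ a i < b i ∧ b i ≤ 1) :
    |(countIn (rectangle a b) N ω : ℝ) / N - (volume (rectangle a b)).toReal| ≤
      discrepancy ω N := by
  refine le_csSup ⟨1, ?_⟩ ⟨a, b, h, rfl⟩
  rintro d ⟨a, b, h, rfl⟩
  have h1 : (countIn (rectangle a b) N ω : ℝ) / N ≤ 1 :=
    div_le_one_of_le₀ (by exact_mod_cast countIn_le _ _ _) (by positivity)
  have h2 : (volume (rectangle a b)).toReal ≤ 1 := by
    rw [volume_rectangle_toReal fun i => (h i).2.1.le]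
    exact Finset.prod_le_one (fun i _ => by linarith [h i]) fun i _ => by linarith [h i]
  have h3 : 0 ≤ (countIn (rectangle a b) N ω : ℝ) / N := by positivity
  have h4 : 0 ≤ (volume (rectangle a b)).toReal := ENNReal.toReal_nonneg
  rw [abs_le]
  constructor <;> linarith

/-- The discrepancy of `N` points is at least `1 / N`. -/
theorem inv_le_discrepancy [Nonempty (Fin n)] {ω : ℕ → Fin n → ℝ} {N : ℕ} (hN : 1 ≤ N)
    (hω : ∀ j, 1 ≤ j → ∀ i, 0 ≤ ω j i) : (N : ℝ)⁻¹ ≤ discrepancy ω N := by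
  have hN' : (0 : ℝ) < N := by exact_mod_cast hN
  -- Half-open rectangles in the cube miss points having a coordinate `1`. If some point avoids
  -- this, small cubes with that point as lower corner give `1 / N`; otherwise the unit rectangle
  -- contains no point and the discrepancy is at least `1`.
  by_cases hex : ∃ j, 1 ≤ j ∧ j ≤ N ∧ ∀ i, ω j i < 1
  · obtain ⟨j, hj1, hjN, hj⟩ := hex
    have hev : ∀ᶠ ε in 𝓝[>] (0 : ℝ), (N : ℝ)⁻¹ - ε ≤ discrepancy ω N := by
      have h1 : ∀ᶠ ε in 𝓝[>] (0 : ℝ), ∀ i, ω j i + ε < 1 := by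
        rw [eventually_all]
        intro i
        filter_upwards [Ioo_mem_nhdsGT (show (0 : ℝ) < 1 - ω j i by linarith [hj i])] with ε hε
        linarith [hε.2]
      filter_upwards [h1, Ioo_mem_nhdsGT (zero_lt_one' ℝ)] with ε hε1 hε
      have hd := abs_countIn_div_sub_volume_le_discrepancy ω N
        (a := ω j) (b := fun i => ω j i + ε)
        fun i => ⟨hω j hj1 i, by linarith [hε.1], (hε1 i).le⟩
      have hvol : (volume (rectangle (ω j) fun i => ω j i + ε)).toReal ≤ ε := by
        rw [volume_rectangle_toReal fun i => by linarith [hε.1]]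
        simp only [add_sub_cancel_left, Finset.prod_const, Finset.card_univ, Fintype.card_fin]
        refine pow_le_of_le_one hε.1.le hε.2.le ?_
        rintro rfl
        exact (Fin.isEmpty.false (Classical.arbitrary (Fin 0)))
      have hc : 1 ≤ countIn (rectangle (ω j) fun i => ω j i + ε) N ω :=
        (Set.ncard_pos (finite_setOf_countIn _ _ _)).2
          ⟨j, hj1, hjN, fun i => ⟨le_rfl, by linarith [hε.1]⟩⟩
      have hc' : (N : ℝ)⁻¹ ≤ (countIn (rectangle (ω j) fun i => ω j i + ε) N ω : ℝ) / N := by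
        rw [inv_eq_one_div]
        gcongr
        exact_mod_cast hc
      linarith [le_abs_self ((countIn (rectangle (ω j) fun i => ω j i + ε) N ω : ℝ) / N -
        (volume (rectangle (ω j) fun i => ω j i + ε)).toReal)]
    have hlim : Tendsto (fun ε : ℝ => (N : ℝ)⁻¹ - ε) (𝓝[>] 0) (𝓝 ((N : ℝ)⁻¹ - 0)) :=
      (tendsto_const_nhds.sub tendsto_id).mono_left nhdsWithin_le_nhds
    rw [sub_zero] at hlim
    exact le_of_tendsto hlim hev
  · push Not at hex
    have hd := abs_countIn_div_sub_volume_le_discrepancy ω N (a := fun _ => 0) (b := fun _ => 1)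
      fun i => ⟨le_rfl, zero_lt_one, le_rfl⟩
    have hc : countIn (rectangle (fun _ => 0) fun _ => 1) N ω = 0 := by
      rw [countIn, Set.ncard_eq_zero (finite_setOf_countIn _ _ _), Set.eq_empty_iff_forall_notMem]
      rintro j ⟨hj1, hjN, hj⟩
      obtain ⟨i, hi⟩ := hex j hj1 hjN
      exact absurd (hj i).2 (not_lt.2 hi)
    rw [hc, volume_rectangle_toReal fun i => zero_le_one] at hd
    refine le_trans (inv_le_one_of_one_le₀ (by exact_mod_cast hN)) ?_
    simpa using hd

/-- A rectangle whose volume is at least a bound for the discrepancy contains a point. -/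
theorem exists_mem_rectangle_of_discrepancy_lt {ω : ℕ → Fin n → ℝ} {N : ℕ} {a b : Fin n → ℝ}
    (h : ∀ i, 0 ≤ a i ∧ a i < b i ∧ b i ≤ 1) (hd : discrepancy ω N < ∏ i, (b i - a i)) :
    ∃ j, 1 ≤ j ∧ j ≤ N ∧ ω j ∈ rectangle a b := by
  have h1 := abs_countIn_div_sub_volume_le_discrepancy ω N h
  rw [volume_rectangle_toReal fun i => (h i).2.1.le] at h1
  have h2 : countIn (rectangle a b) N ω ≠ 0 := by
    intro h0
    rw [h0] at h1
    have := neg_abs_le ((0 : ℕ) / (N : ℝ) - ∏ i, (b i - a i))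
    simp only [Nat.cast_zero, zero_div, zero_sub] at this h1
    linarith
  exact Set.nonempty_of_ncard_ne_zero h2

theorem countIn_le_of_discrepancy {ω : ℕ → Fin n → ℝ} {N : ℕ} (hN : 1 ≤ N) {a b : Fin n → ℝ}
    (h : ∀ i, 0 ≤ a i ∧ a i < b i ∧ b i ≤ 1) :
    (countIn (rectangle a b) N ω : ℝ) ≤ N * (∏ i, (b i - a i) + discrepancy ω N) := by
  have hN' : (0 : ℝ) < N := by exact_mod_cast hN
  have h1 := (le_abs_self _).trans (abs_countIn_div_sub_volume_le_discrepancy ω N h)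
  rw [volume_rectangle_toReal fun i => (h i).2.1.le, sub_le_iff_le_add, div_le_iff₀ hN'] at h1
  linarith

/-! ### Selecting points by a grid -/

/-- The index of the cell containing `y` in the grid of mesh `s` with origin `a`. -/
noncomputable def gridIndex (a s y : Fin n → ℝ) : Fin n → ℤ := fun k => ⌊(y k - a k) / s k⌋

/-- In each coordinate, an interval of length `2 h k` meets at most `2 h k / s k + 2` cells of
length `s k`. Occupied cells are counted, not points. -/
theorem card_image_gridIndex_le [DecidableEq (Fin n → ℤ)] (a s p h : Fin n → ℝ)
    (hs : ∀ k, 0 < s k) (hh : ∀ k, 0 ≤ h k) {ω : ℕ → Fin n → ℝ} (F : Finset ℕ)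
    (hF : ∀ j ∈ F, ∀ k, |p k - ω j k| < h k) :
    ((F.image fun j => gridIndex a s (ω j)).card : ℝ) ≤ ∏ k, (2 * h k / s k + 2) := by
  have hsub : (F.image fun j => gridIndex a s (ω j)) ⊆ Fintype.piFinset fun k =>
      Finset.Icc ⌊(p k - h k - a k) / s k⌋ ⌊(p k + h k - a k) / s k⌋ := by
    intro g hg
    obtain ⟨j, hj, rfl⟩ := Finset.mem_image.1 hg
    rw [Fintype.mem_piFinset]
    intro k
    have := abs_lt.1 (hF j hj k)
    have hk := hs k
    rw [Finset.mem_Icc]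
    constructor <;> refine Int.floor_le_floor ?_ <;> gcongr <;> linarith
  have hcard := Finset.card_le_card hsub
  rw [Fintype.card_piFinset] at hcard
  refine (Nat.cast_le.2 hcard).trans ?_
  rw [Nat.cast_prod]
  refine Finset.prod_le_prod (fun k _ => by positivity) fun k _ => ?_
  have hk := hs k
  have hle : (p k - h k - a k) / s k ≤ (p k + h k - a k) / s k := by
    gcongr; linarith [hh k]
  rw [Int.card_Icc]
  have h0 : (0 : ℤ) ≤ ⌊(p k + h k - a k) / s k⌋ + 1 - ⌊(p k - h k - a k) / s k⌋ := by
    have := Int.floor_le_floor hle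
    omega
  have h1 : (((⌊(p k + h k - a k) / s k⌋ + 1 - ⌊(p k - h k - a k) / s k⌋).toNat : ℕ) : ℝ) =
      (⌊(p k + h k - a k) / s k⌋ : ℝ) + 1 - ⌊(p k - h k - a k) / s k⌋ := by
    have := Int.toNat_of_nonneg h0
    rw [← Int.cast_natCast, this]
    push_cast
    ring
  rw [h1]
  have h2 := Int.floor_le ((p k + h k - a k) / s k)
  have h3 := Int.lt_floor_add_one ((p k - h k - a k) / s k)
  have h4 : (p k + h k - a k) / s k - (p k - h k - a k) / s k = 2 * h k / s k := by
    field_simp; ring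
  linarith

/-- Among the points `ω j`, `N < j ≤ N'`, of a cube one finds a well distributed family, having at
most one member in every cell of a grid whose cells have volume larger than the discrepancy. -/
theorem exists_well_distributed {ω : ℕ → Fin n → ℝ} {N N' : ℕ} (hN : 1 ≤ N)
    {x s : Fin n → ℝ} {r : ℝ} (hr : 0 < r) (hx : ∀ k, 0 ≤ x k - r ∧ x k + r ≤ 1)
    (hs : ∀ k, 0 < s k) (hD : discrepancy ω N' < ∏ k, s k) :
    ∃ G : Finset ℕ, (∀ j ∈ G, N < j ∧ j ≤ N' ∧ ∀ k, |ω j k - x k| ≤ r) ∧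
      ∏ k, (⌊2 * r / s k⌋ : ℝ) - N * ((2 * r) ^ n + discrepancy ω N) ≤ G.card ∧
      (G.card : ℝ) ≤ ∏ k, (2 * r / s k) ∧
      ∀ p h : Fin n → ℝ, (∀ k, 0 ≤ h k) →
        ((G.filter fun j => ∀ k, |p k - ω j k| < h k).card : ℝ) ≤ ∏ k, (2 * h k / s k + 2) := by
  classical
  set a : Fin n → ℝ := fun k => x k - r with ha
  set γ : ℕ → Fin n → ℤ := fun j => gridIndex a s (ω j) with hγ
  have hfl : ∀ k, 0 ≤ ⌊2 * r / s k⌋ := fun k =>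
    Int.floor_nonneg.2 (div_nonneg (by linarith) (hs k).le)
  -- Only the cells lying wholly inside the cube; the incomplete ones at the upper faces are
  -- dropped.
  set T : Finset (Fin n → ℤ) := Fintype.piFinset fun k => Finset.Ico (0 : ℤ) ⌊2 * r / s k⌋
    with hT
  have hTcard : (T.card : ℝ) = ∏ k, (⌊2 * r / s k⌋ : ℝ) := by
    rw [hT, Fintype.card_piFinset, Nat.cast_prod]
    refine Finset.prod_congr rfl fun k _ => ?_
    rw [Int.card_Ico, sub_zero, ← Int.cast_natCast, Int.toNat_of_nonneg (hfl k)]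
  have hmemT : ∀ y : Fin n → ℝ, gridIndex a s y ∈ T → ∀ k, x k - r ≤ y k ∧ y k < x k + r := by
    intro y hy k
    have h1 := Finset.mem_Ico.1 (Fintype.mem_piFinset.1 hy k)
    have h2 : 0 ≤ (y k - a k) / s k := Int.floor_nonneg.1 h1.1
    have h3 : (y k - a k) / s k < 2 * r / s k := by
      have e1 := Int.lt_floor_add_one ((y k - a k) / s k)
      have e2 : ((⌊(y k - a k) / s k⌋ + 1 : ℤ) : ℝ) ≤ ⌊2 * r / s k⌋ :=
        Int.cast_le.2 (Int.add_one_le_iff.2 h1.2)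
      push_cast at e2
      linarith [Int.floor_le (2 * r / s k)]
    have h4 := (div_lt_div_iff_of_pos_right (hs k)).1 h3
    have h5 : 0 ≤ y k - a k := by
      have := mul_nonneg h2 (hs k).le
      rwa [div_mul_cancel₀ _ (hs k).ne'] at this
    simp only [ha] at h4 h5
    constructor <;> linarith
  have hsurj : ∀ g ∈ T, ∃ j, 1 ≤ j ∧ j ≤ N' ∧ γ j = g := by
    intro g hg
    have hg' := fun k => Finset.mem_Ico.1 (Fintype.mem_piFinset.1 hg k)
    have hbox : ∀ k, 0 ≤ a k + g k * s k ∧ a k + g k * s k < a k + (g k + 1) * s k ∧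
        a k + (g k + 1) * s k ≤ 1 := by
      intro k
      have h0 : (0 : ℝ) ≤ g k := by exact_mod_cast (hg' k).1
      have h1 : ((g k + 1 : ℤ) : ℝ) ≤ ⌊2 * r / s k⌋ := by
        exact_mod_cast Int.add_one_le_iff.2 (hg' k).2
      push_cast at h1
      have h2 : (g k + 1 : ℝ) ≤ 2 * r / s k := h1.trans (Int.floor_le _)
      rw [le_div_iff₀ (hs k)] at h2
      have h3 := mul_nonneg h0 (hs k).le
      have h4 := hx k
      refine ⟨?_, ?_, ?_⟩ <;> simp only [ha] <;> nlinarith [hs k]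
    obtain ⟨j, hj1, hjN, hj⟩ := exists_mem_rectangle_of_discrepancy_lt (ω := ω) (N := N') hbox
      (by convert hD using 3; ring)
    refine ⟨j, hj1, hjN, funext fun k => ?_⟩
    have := hj k
    rw [hγ]
    simp only [gridIndex]
    rw [Int.floor_eq_iff, le_div_iff₀ (hs k), div_lt_iff₀ (hs k)]
    constructor <;> linarith
  -- Discarding the cells met by these early points forces the representative of each remaining cell
  -- to have index above `N`.
  set S : Finset ℕ := (Finset.Icc 1 N).filter fun j => γ j ∈ T with hS
  have hScard : (S.card : ℝ) ≤ N * ((2 * r) ^ n + discrepancy ω N) := by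
    have h1 : S.card ≤ countIn (rectangle (fun k => x k - r) fun k => x k + r) N ω := by
      rw [countIn, ← Set.ncard_coe_finset]
      refine Set.ncard_le_ncard (fun j hj => ?_) (finite_setOf_countIn _ _ _)
      have hj' := Finset.mem_filter.1 (Finset.mem_coe.1 hj)
      exact ⟨(Finset.mem_Icc.1 hj'.1).1, (Finset.mem_Icc.1 hj'.1).2, hmemT _ hj'.2⟩
    have h2 := countIn_le_of_discrepancy (ω := ω) hN (a := fun k => x k - r)
      (b := fun k => x k + r) fun k => ⟨(hx k).1, by linarith, (hx k).2⟩
    refine (Nat.cast_le.2 h1).trans (h2.trans_eq ?_)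
    have : ∀ k : Fin n, x k + r - (x k - r) = 2 * r := fun k => by ring
    simp [this]
  have hgood : ∀ g ∈ T \ S.image γ, ∃ j, N < j ∧ j ≤ N' ∧ γ j = g := by
    intro g hg
    obtain ⟨hgT, hgS⟩ := Finset.mem_sdiff.1 hg
    obtain ⟨j, hj1, hjN, rfl⟩ := hsurj g hgT
    refine ⟨j, ?_, hjN, rfl⟩
    by_contra hlt
    exact hgS (Finset.mem_image_of_mem _
      (Finset.mem_filter.2 ⟨Finset.mem_Icc.2 ⟨hj1, not_lt.1 hlt⟩, hgT⟩))
  choose! σ hσN hσN' hσγ using hgood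
  set G : Finset ℕ := (T \ S.image γ).image σ with hG
  have hγG : Set.InjOn γ G := by
    intro j hj j' hj' hjj
    obtain ⟨g, hg, rfl⟩ := Finset.mem_image.1 (Finset.mem_coe.1 hj)
    obtain ⟨g', hg', rfl⟩ := Finset.mem_image.1 (Finset.mem_coe.1 hj')
    rw [hσγ g hg, hσγ g' hg'] at hjj
    rw [hjj]
  have hGcard : G.card = (T \ S.image γ).card := by
    refine Finset.card_image_of_injOn fun g hg g' hg' h => ?_
    rw [← hσγ g hg, ← hσγ g' hg']
    exact congrArg γ h
  refine ⟨G, ?_, ?_, ?_, ?_⟩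
  · intro j hj
    obtain ⟨g, hg, rfl⟩ := Finset.mem_image.1 hj
    refine ⟨hσN g hg, hσN' g hg, fun k => ?_⟩
    have h1 : γ (σ g) ∈ T := by
      rw [hσγ g hg]; exact (Finset.mem_sdiff.1 hg).1
    have h2 := hmemT _ h1 k
    rw [abs_le]
    constructor <;> linarith
  · have h1 : T.card ≤ G.card + S.card := by
      rw [hGcard]
      have := Finset.le_card_sdiff (S.image γ) T
      have := Finset.card_image_le (s := S) (f := γ)
      omega
    have h2 : (T.card : ℝ) ≤ G.card + S.card := by exact_mod_cast h1
    rw [← hTcard]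
    linarith
  · have h1 : (G.card : ℝ) ≤ T.card := by
      rw [hGcard]
      exact_mod_cast Finset.card_le_card Finset.sdiff_subset
    rw [hTcard] at h1
    exact h1.trans (Finset.prod_le_prod (fun k _ => by exact_mod_cast hfl k)
      fun k _ => Int.floor_le _)
  · intro p h hh
    have h1 := card_image_gridIndex_le a s p h hs hh
      (G.filter fun j => ∀ k, |p k - ω j k| < h k) fun j hj => (Finset.mem_filter.1 hj).2
    rwa [Finset.card_image_of_injOn (hγG.mono fun j hj => (Finset.mem_filter.1 hj).1)] at h1

/-! ### Boxes and their overlaps -/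

/-- The open box with centre `p` and half side lengths `h`. -/
def openBox (p h : Fin n → ℝ) : Set (Fin n → ℝ) := {y | ∀ k, |y k - p k| < h k}

theorem openBox_eq_pi (p h : Fin n → ℝ) :
    openBox p h = Set.pi Set.univ fun k => Set.Ioo (p k - h k) (p k + h k) := by
  ext y
  simp only [openBox, Set.mem_ofPred_eq, Set.mem_pi, Set.mem_univ, true_implies, Set.mem_Ioo,
    abs_lt]
  exact forall_congr' fun k => by constructor <;> rintro ⟨h1, h2⟩ <;> constructor <;> linarith

theorem isOpen_openBox (p h : Fin n → ℝ) : IsOpen (openBox p h) := by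
  rw [openBox_eq_pi]
  exact isOpen_set_pi Set.finite_univ fun _ _ => isOpen_Ioo

theorem volume_openBox_ne_top (p h : Fin n → ℝ) : volume (openBox p h) ≠ ⊤ := by
  rw [openBox_eq_pi, Real.volume_pi_Ioo]
  exact ENNReal.prod_ne_top fun _ _ => ENNReal.ofReal_ne_top

theorem volume_real_openBox (p : Fin n → ℝ) {h : Fin n → ℝ} (hh : ∀ k, 0 ≤ h k) :
    volume.real (openBox p h) = 2 ^ n * ∏ k, h k := by
  rw [openBox_eq_pi, Measure.real, Real.volume_pi_Ioo_toReal fun k => by linarith [hh k]]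
  have : ∀ k, p k + h k - (p k - h k) = 2 * h k := fun k => by ring
  simp [this, Finset.prod_mul_distrib]

/-- If some `a k ≤ q`, that factor becomes `q` and the others are at most `1`; otherwise no maximum
changes anything. -/
theorem prod_max_le_prod_add {ι : Type*} (F : Finset ι) {a : ι → ℝ} {q : ℝ} (hq : 0 ≤ q)
    (hq1 : q ≤ 1) (ha : ∀ k, 0 ≤ a k) (ha1 : ∀ k, a k ≤ 1) :
    ∏ k ∈ F, max (a k) q ≤ ∏ k ∈ F, a k + q := by
  by_cases h : ∃ k ∈ F, a k ≤ q
  · obtain ⟨k, hk, hkq⟩ := h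
    classical
    rw [← Finset.mul_prod_erase F _ hk, max_eq_right hkq]
    have h1 : ∏ x ∈ F.erase k, max (a x) q ≤ 1 := Finset.prod_le_one
      (fun x _ => hq.trans (le_max_right _ _)) fun x _ => max_le (ha1 x) hq1
    have h2 : 0 ≤ ∏ k ∈ F, a k := Finset.prod_nonneg fun x _ => ha x
    nlinarith
  · push Not at h
    rw [Finset.prod_congr rfl fun k hk => max_eq_left (h k hk).le]
    linarith

theorem prod_rpow_eq_self {τ : Fin n → ℝ} (hτ : ∑ i, τ i = 1) {V : ℝ} (hV : 0 < V) :
    ∏ k, V ^ τ k = V := by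
  rw [← Real.rpow_sum_of_pos hV, hτ, Real.rpow_one]

/-- The total overlap of two families of boxes around well distributed points. -/
theorem sum_sum_volume_inter_le {ω : ℕ → Fin n → ℝ} {G G' : Finset ℕ} {V V' L q : ℝ}
    {τ h h' : Fin n → ℝ} (hτ : ∑ i, τ i = 1) (hV : 0 < V) (hV' : 0 < V')
    (hh' : ∀ k, 0 ≤ h' k) (hle : ∀ k, h' k ≤ h k) (hhV : ∀ k, h k ≤ V ^ τ k)
    (hG : G.card * V ≤ L)
    (hG' : ∀ p h : Fin n → ℝ, (∀ k, 0 ≤ h k) →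
      ((G'.filter fun j => ∀ k, |p k - ω j k| < h k).card : ℝ) ≤ ∏ k, (2 * h k / V' ^ τ k + 2))
    (hq0 : 0 ≤ q) (hq1 : q ≤ 1) (hq : ∀ k, (V' / V) ^ τ k ≤ q) :
    ∑ j ∈ G, ∑ j' ∈ G', volume.real (openBox (ω j) h ∩ openBox (ω j') h') ≤
      12 ^ n * L * ((V'⁻¹ * ∏ k, h' k) * (V⁻¹ * ∏ k, h k + q)) := by
  have hh : ∀ k, 0 ≤ h k := fun k => (hh' k).trans (hle k)
  have hP' : 0 ≤ ∏ k, h' k := Finset.prod_nonneg fun k _ => hh' k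
  have hP : 0 ≤ ∏ k, h k := Finset.prod_nonneg fun k _ => hh k
  -- Counts the points of `G'` within `2 h` of a given centre. In each factor `4 + 2 = 6`, the
  -- additive `2` being absorbed through `1 ≤ (V / V') ^ τ k * q`.
  have hcount : ∏ k, (2 * (2 * h k) / V' ^ τ k + 2) ≤
      6 ^ n * ((V / V') * (V⁻¹ * ∏ k, h k + q)) := by
    have hfac : ∀ k, 2 * (2 * h k) / V' ^ τ k + 2 ≤
        6 * ((V / V') ^ τ k * max (h k / V ^ τ k) q) := by
      intro k
      have hs := Real.rpow_pos_of_pos hV (τ k)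
      have hs' := Real.rpow_pos_of_pos hV' (τ k)
      rw [Real.div_rpow hV.le hV'.le]
      have e1 : h k / V' ^ τ k ≤ V ^ τ k / V' ^ τ k * max (h k / V ^ τ k) q := by
        calc h k / V' ^ τ k = V ^ τ k / V' ^ τ k * (h k / V ^ τ k) := by field_simp
          _ ≤ _ := mul_le_mul_of_nonneg_left (le_max_left _ _) (by positivity)
      have e2 : 1 ≤ V ^ τ k / V' ^ τ k * max (h k / V ^ τ k) q := by
        calc (1 : ℝ) = V ^ τ k / V' ^ τ k * (V' ^ τ k / V ^ τ k) := by field_simp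
          _ = V ^ τ k / V' ^ τ k * (V' / V) ^ τ k := by rw [Real.div_rpow hV'.le hV.le]
          _ ≤ _ := mul_le_mul_of_nonneg_left ((hq k).trans (le_max_right _ _)) (by positivity)
      have e3 : 2 * (2 * h k) / V' ^ τ k = 4 * (h k / V' ^ τ k) := by ring
      linarith
    refine (Finset.prod_le_prod (fun k _ => ?_) fun k _ => hfac k).trans ?_
    · have := hh k
      positivity
    · rw [Finset.prod_mul_distrib, Finset.prod_mul_distrib, prod_rpow_eq_self hτ (div_pos hV hV'),
        Finset.prod_const, Finset.card_univ, Fintype.card_fin]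
      have := prod_max_le_prod_add Finset.univ (a := fun k => h k / V ^ τ k) hq0 hq1
        (fun k => div_nonneg (hh k) (Real.rpow_nonneg hV.le _))
        (fun k => (div_le_one (Real.rpow_pos_of_pos hV _)).2 (hhV k))
      rw [Finset.prod_div_distrib, prod_rpow_eq_self hτ hV] at this
      have e : V⁻¹ * ∏ k, h k = (∏ k, h k) / V := by ring
      rw [e]
      gcongr
  have hinner : ∀ j ∈ G, ∑ j' ∈ G', volume.real (openBox (ω j) h ∩ openBox (ω j') h') ≤
      6 ^ n * ((V / V') * (V⁻¹ * ∏ k, h k + q)) * (2 ^ n * ∏ k, h' k) := by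
    intro j _
    -- Boxes meet only if their centres differ by less than `h k + h' k ≤ 2 * h k` in each
    -- coordinate; then the smaller box bounds the overlap.
    have hterm : ∀ j' ∈ G', volume.real (openBox (ω j) h ∩ openBox (ω j') h') ≤
        if ∀ k, |ω j k - ω j' k| < 2 * h k then 2 ^ n * ∏ k, h' k else 0 := by
      intro j' _
      split_ifs with hc
      · rw [← volume_real_openBox (ω j') hh']
        exact measureReal_mono Set.inter_subset_right (volume_openBox_ne_top _ _)
      · have : openBox (ω j) h ∩ openBox (ω j') h' = ∅ := by
          rw [Set.eq_empty_iff_forall_notMem]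
          rintro y ⟨h1, h2⟩
          refine hc fun k => ?_
          have h3 := h1 k
          have h4 := h2 k
          have h5 := hle k
          rw [abs_lt] at h3 h4 ⊢
          constructor <;> linarith
        simp [this]
    refine (Finset.sum_le_sum hterm).trans ?_
    rw [← Finset.sum_filter, Finset.sum_const, nsmul_eq_mul]
    gcongr
    exact (hG' (ω j) (fun k => 2 * h k) fun k => by linarith [hh k]).trans hcount
  refine (Finset.sum_le_sum hinner).trans ?_
  rw [Finset.sum_const, nsmul_eq_mul]
  have e12 : (12 : ℝ) ^ n = 6 ^ n * 2 ^ n := by rw [← mul_pow]; norm_num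
  calc (G.card : ℝ) * (6 ^ n * ((V / V') * (V⁻¹ * ∏ k, h k + q)) * (2 ^ n * ∏ k, h' k))
      = 12 ^ n * (G.card * V) * ((V'⁻¹ * ∏ k, h' k) * (V⁻¹ * ∏ k, h k + q)) := by
        rw [e12]; ring
    _ ≤ _ := by gcongr

/-- Summation of a symmetric array that decays geometrically off the diagonal, up to a rank one
term. -/
theorem sum_sum_le_sq_add {I : ℕ → ℕ → ℝ} (hI : ∀ i l, I i l = I l i) {K ρ : ℝ} (hK : 0 ≤ K)
    (hρ0 : 0 ≤ ρ) (hρ1 : ρ < 1) {φ : ℕ → ℝ} (hφ : ∀ i, 0 ≤ φ i) (F : Finset ℕ)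
    (h : ∀ i ∈ F, ∀ l ∈ F, i ≤ l → I i l ≤ K * (φ l * (φ i + ρ ^ (l - i)))) :
    ∑ i ∈ F, ∑ l ∈ F, I i l ≤ K * ((∑ i ∈ F, φ i) ^ 2 + 2 / (1 - ρ) * ∑ i ∈ F, φ i) := by
  -- One-sided weight: using both `w i l` and `w l i` covers either order of the indices, whence the
  -- factor `2` in `2 / (1 - ρ)`.
  set w : ℕ → ℕ → ℝ := fun i l => if i ≤ l then ρ ^ (l - i) else 0 with hw
  have hw0 : ∀ i l, 0 ≤ w i l := fun i l => by
    simp only [hw]; split_ifs <;> positivity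
  have hterm : ∀ i ∈ F, ∀ l ∈ F, I i l ≤ K * (φ i * φ l + φ l * w i l + φ i * w l i) := by
    intro i hi l hl
    rcases le_total i l with hil | hil
    · refine (h i hi l hl hil).trans (mul_le_mul_of_nonneg_left ?_ hK)
      have : w i l = ρ ^ (l - i) := by simp [hw, hil]
      rw [this]
      nlinarith [mul_nonneg (hφ i) (hw0 l i)]
    · rw [hI]
      refine (h l hl i hi hil).trans (mul_le_mul_of_nonneg_left ?_ hK)
      have : w l i = ρ ^ (i - l) := by simp [hw, hil]
      rw [this]
      nlinarith [mul_nonneg (hφ l) (hw0 i l)]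
  have hgeom : ∀ l, ∑ i ∈ F, w i l ≤ (1 - ρ)⁻¹ := by
    intro l
    calc ∑ i ∈ F, w i l = ∑ i ∈ F.filter fun i => i ≤ l, ρ ^ (l - i) :=
          (Finset.sum_filter _ _).symm
      _ ≤ ∑ i ∈ Finset.range (l + 1), ρ ^ (l - i) := by
          refine Finset.sum_le_sum_of_subset_of_nonneg (fun i hi => ?_) fun i _ _ => by positivity
          have := (Finset.mem_filter.1 hi).2
          exact Finset.mem_range.2 (by omega)
      _ = ∑ i ∈ Finset.range (l + 1), ρ ^ i := by
          rw [← Finset.sum_range_reflect]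
          refine Finset.sum_congr rfl fun i hi => ?_
          have := Finset.mem_range.1 hi
          congr 1
          omega
      _ ≤ ∑' i, ρ ^ i := (summable_geometric_of_lt_one hρ0 hρ1).sum_le_tsum _
          fun i _ => by positivity
      _ = (1 - ρ)⁻¹ := tsum_geometric_of_lt_one hρ0 hρ1
  have hA : ∑ i ∈ F, ∑ l ∈ F, φ i * w l i ≤ (1 - ρ)⁻¹ * ∑ i ∈ F, φ i := by
    rw [Finset.mul_sum]
    refine Finset.sum_le_sum fun i _ => ?_
    rw [← Finset.mul_sum, mul_comm]
    exact mul_le_mul_of_nonneg_right (hgeom i) (hφ i)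
  have hB : ∑ i ∈ F, ∑ l ∈ F, φ l * w i l = ∑ i ∈ F, ∑ l ∈ F, φ i * w l i := Finset.sum_comm
  calc ∑ i ∈ F, ∑ l ∈ F, I i l
      ≤ ∑ i ∈ F, ∑ l ∈ F, K * (φ i * φ l + φ l * w i l + φ i * w l i) :=
        Finset.sum_le_sum fun i hi => Finset.sum_le_sum fun l hl => hterm i hi l hl
    _ = K * ((∑ i ∈ F, φ i) ^ 2 + ∑ i ∈ F, ∑ l ∈ F, φ l * w i l +
          ∑ i ∈ F, ∑ l ∈ F, φ i * w l i) := by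
        rw [sq, Finset.sum_mul_sum]
        simp only [mul_add, Finset.sum_add_distrib, Finset.mul_sum]
    _ ≤ _ := by
        refine mul_le_mul_of_nonneg_left ?_ hK
        have : 2 / (1 - ρ) = (1 - ρ)⁻¹ + (1 - ρ)⁻¹ := by ring
        rw [this, add_mul]
        linarith

/-! ### Well distributed families in each block -/

/-- For all large `i`, the points `ω j` with `𝒩 i < j ≤ 𝒩 (i + 1)` contain a well distributed
family filling a fixed proportion of a given cube. -/
theorem eventually_exists_well_distributed {𝒩 : ℕ → ℕ} {v : ℕ → ℝ} {ω : ℕ → Fin n → ℝ}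
    (hω : IsDiscrepancySatisfying 𝒩 v ω) (hv : ∀ i, 0 < v (𝒩 i)) {τ : Fin n → ℝ}
    (hτ_pos : ∀ i, 0 < τ i) (hτ_sum : ∑ i, τ i = 1) {θ : ℝ} (hθ : θ < 1)
    (hNv : ∀ᶠ i in atTop, 𝒩 i * v (𝒩 (i + 1)) ≤ θ) {x : Fin n → ℝ} {r : ℝ} (hr : 0 < r)
    (hx : ∀ k, 0 ≤ x k - r ∧ x k + r ≤ 1) :
    ∀ᶠ i in atTop, ∃ G : Finset ℕ,
      (∀ j ∈ G, 𝒩 i < j ∧ j ≤ 𝒩 (i + 1) ∧ ∀ k, |ω j k - x k| ≤ r) ∧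
      (1 - θ) / 2 * (2 * r) ^ n ≤ G.card * v (𝒩 (i + 1)) ∧
      G.card * v (𝒩 (i + 1)) ≤ (2 * r) ^ n ∧
      ∀ p h : Fin n → ℝ, (∀ k, 0 ≤ h k) →
        ((G.filter fun j => ∀ k, |p k - ω j k| < h k).card : ℝ) ≤
          ∏ k, (2 * h k / v (𝒩 (i + 1)) ^ τ k + 2) := by
  have hlim : Tendsto (fun i => v (𝒩 i)) atTop (𝓝 0) :=
    hω.tendsto_zero.comp hω.index_strictMono.tendsto_atTop
  have hlim1 : Tendsto (fun i => v (𝒩 (i + 1))) atTop (𝓝 0) :=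
    hlim.comp (tendsto_add_atTop_nat 1)
  have hs : ∀ k, Tendsto (fun i => v (𝒩 (i + 1)) ^ τ k) atTop (𝓝 0) := fun k => by
    have := hlim1.rpow_const (Or.inr (hτ_pos k).le)
    rwa [Real.zero_rpow (hτ_pos k).ne'] at this
  have hsmall : ∀ᶠ i in atTop, ∀ k, v (𝒩 (i + 1)) ^ τ k < 2 * r :=
    eventually_all.2 fun k => (hs k).eventually_lt_const (by linarith)
  -- The normalised lower bound for the number of cells kept: full cells minus cells lost to the
  -- first `𝒩 i` points. Half of its limit is what the lemma claims.
  have hmain : Tendsto (fun i => ∏ k, (2 * r - v (𝒩 (i + 1)) ^ τ k) -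
      θ * ((2 * r) ^ n + v (𝒩 i))) atTop (𝓝 ((1 - θ) * (2 * r) ^ n)) := by
    have h1 := (tendsto_finsetProd (Finset.univ : Finset (Fin n))
      fun k _ => (hs k).const_sub (2 * r)).sub
      ((hlim.const_add ((2 * r) ^ n)).const_mul θ)
    convert h1 using 2
    simp
    ring
  have hpow : 0 < (2 * r) ^ n := by positivity
  have hgt := hmain.eventually_const_lt
    (show (1 - θ) / 2 * (2 * r) ^ n < (1 - θ) * (2 * r) ^ n by nlinarith)
  filter_upwards [hNv, hsmall, hgt] with i hNvi hsi hgti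
  set V := v (𝒩 (i + 1)) with hV
  have hVpos : 0 < V := hv _
  have hspos : ∀ k, 0 < V ^ τ k := fun k => Real.rpow_pos_of_pos hVpos _
  obtain ⟨G, hG1, hG2, hG3, hG4⟩ := exists_well_distributed (ω := ω) (hω.index_pos i)
    (N' := 𝒩 (i + 1)) hr hx hspos (by
      rw [prod_rpow_eq_self hτ_sum hVpos]; exact hω.discrepancy_lt _)
  refine ⟨G, hG1, ?_, ?_, hG4⟩
  · have hD := (hω.discrepancy_lt i).le
    have e1 : ∏ k, (2 * r - V ^ τ k) ≤ (∏ k, (⌊2 * r / V ^ τ k⌋ : ℝ)) * V := by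
      have e0 : (∏ k, (⌊2 * r / V ^ τ k⌋ : ℝ)) * V = ∏ k, (⌊2 * r / V ^ τ k⌋ : ℝ) * V ^ τ k := by
        rw [Finset.prod_mul_distrib, prod_rpow_eq_self hτ_sum hVpos]
      rw [e0]
      refine Finset.prod_le_prod (fun k _ => by linarith [hsi k]) fun k _ => ?_
      have h1 := (Int.sub_one_lt_floor (2 * r / V ^ τ k)).le
      have h2 := mul_le_mul_of_nonneg_right h1 (hspos k).le
      rw [sub_mul, div_mul_cancel₀ _ (hspos k).ne', one_mul] at h2
      exact h2
    have hvi := hv i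
    have e2 : (𝒩 i : ℝ) * ((2 * r) ^ n + discrepancy ω (𝒩 i)) * V ≤
        θ * ((2 * r) ^ n + v (𝒩 i)) := by
      calc (𝒩 i : ℝ) * ((2 * r) ^ n + discrepancy ω (𝒩 i)) * V
          ≤ (𝒩 i : ℝ) * ((2 * r) ^ n + v (𝒩 i)) * V := by gcongr
        _ = (𝒩 i * V) * ((2 * r) ^ n + v (𝒩 i)) := by ring
        _ ≤ _ := by gcongr
    have e3 := mul_le_mul_of_nonneg_right hG2 hVpos.le
    rw [sub_mul] at e3
    linarith
  · have e1 := mul_le_mul_of_nonneg_right hG3 hVpos.le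
    refine e1.trans_eq ?_
    rw [Finset.prod_div_distrib, prod_rpow_eq_self hτ_sum hVpos, div_mul_cancel₀ _ hVpos.ne']
    simp

/-! ### Tail sets and their local density -/

/-- The points lying in the `j`-th box for some `j ≥ m`. -/
def tailSet (ω : ℕ → Fin n → ℝ) (ψ : Fin n → ℕ → ℝ) (m : ℕ) : Set (Fin n → ℝ) :=
  {y | ∃ j, m ≤ j ∧ 1 ≤ j ∧ ∀ k, |y k - ω j k| < ψ k j}

theorem isOpen_tailSet (ω : ℕ → Fin n → ℝ) (ψ : Fin n → ℕ → ℝ) (m : ℕ) :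
    IsOpen (tailSet ω ψ m) := by
  have : tailSet ω ψ m = ⋃ j, ⋃ (_ : m ≤ j ∧ 1 ≤ j), openBox (ω j) fun k => ψ k j := by
    ext y
    simp [tailSet, openBox, and_assoc]
  rw [this]
  exact isOpen_iUnion fun j => isOpen_iUnion fun _ => isOpen_openBox _ _

theorem approxSet_eq (ω : ℕ → Fin n → ℝ) (ψ : Fin n → ℕ → ℝ) :
    approxSet ω ψ = Set.Icc 0 1 ∩ ⋂ m, tailSet ω ψ m := by
  ext y
  simp only [approxSet, tailSet, Set.mem_ofPred_eq, Set.mem_inter_iff, Set.mem_Icc, Pi.le_def,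
    Pi.zero_apply, Pi.one_apply, Set.mem_iInter, ← forall_and]
  refine and_congr_right fun _ => ?_
  rw [← Nat.frequently_atTop_iff_infinite, frequently_atTop]

/-- Every small cube is filled to a fixed proportion by the boxes with large index. -/
theorem exists_le_volume_tailSet_inter {𝒩 : ℕ → ℕ} {v : ℕ → ℝ} {ω : ℕ → Fin n → ℝ}
    {ψ : Fin n → ℕ → ℝ} {τ : Fin n → ℝ} (hω : IsDiscrepancySatisfying 𝒩 v ω)
    (hψ_nonneg : ∀ i N, 1 ≤ N → 0 ≤ ψ i N) (hψ_anti : ∀ i, AntitoneOn (ψ i) (Set.Ici 1))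
    (hτ_pos : ∀ i, 0 < τ i) (hτ_sum : ∑ i, τ i = 1)
    (hψ_le : ∀ᶠ N in atTop, ∀ i, ψ i N ≤ v N ^ τ i)
    (hdiv : ¬ Summable (fun j : ℕ => (v (𝒩 j))⁻¹ * ∏ i, ψ i (𝒩 j)))
    (hv : ∀ i, 0 < v (𝒩 i)) {θ : ℝ} (hθ0 : 0 < θ) (hθ : θ < 1)
    (hNv : ∀ᶠ i in atTop, 𝒩 i * v (𝒩 (i + 1)) ≤ θ)
    (hvreg : ∀ᶠ i in atTop, v (𝒩 (i + 1)) ≤ θ * v (𝒩 i)) :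
    ∃ κ : ℝ, 0 < κ ∧ ∀ (x : Fin n → ℝ) (r : ℝ), 0 < r →
      (∀ k, 0 ≤ x k - r ∧ x k + r ≤ 1) → ∀ m,
        κ * (2 * r) ^ n ≤ volume.real (tailSet ω ψ m ∩ Metric.closedBall x (2 * r)) := by
  -- One ratio for all coordinates, available because every `τ k` is positive.
  obtain ⟨ρ, hρ0, hρ1, hρ⟩ : ∃ ρ : ℝ, 0 ≤ ρ ∧ ρ < 1 ∧ ∀ k, θ ^ τ k ≤ ρ := by
    have h1 : ∀ᶠ ρ in 𝓝[<] (1 : ℝ), ∀ k, θ ^ τ k ≤ ρ := eventually_all.2 fun k => by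
      filter_upwards [Ioo_mem_nhdsLT (Real.rpow_lt_one hθ0.le hθ (hτ_pos k))] with ρ hρ
      exact hρ.1.le
    obtain ⟨ρ, hρ, hρ'⟩ := (h1.and (Ioo_mem_nhdsLT (zero_lt_one' ℝ))).exists
    exact ⟨ρ, hρ'.1.le, hρ'.2, hρ⟩
  set B : ℝ := 1 + 2 / (1 - ρ) with hB
  have hBpos : 0 < B := by
    have : 0 < 1 - ρ := by linarith
    positivity
  have hθ' : 0 < (1 - θ) / 2 := by linarith
  refine ⟨((1 - θ) / 2) ^ 2 / (12 ^ n * B), by positivity, fun x r hr hx m => ?_⟩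
  have hN1 : ∀ i, 1 ≤ 𝒩 i := hω.index_pos
  have htop : Tendsto (fun i => 𝒩 (i + 1)) atTop atTop :=
    hω.index_strictMono.tendsto_atTop.comp (tendsto_add_atTop_nat 1)
  have hlim : Tendsto (fun i => v (𝒩 (i + 1))) atTop (𝓝 0) := hω.tendsto_zero.comp htop
  have hsmall : ∀ᶠ i in atTop, ∀ k, v (𝒩 (i + 1)) ^ τ k < r :=
    eventually_all.2 fun k => by
      have := hlim.rpow_const (Or.inr (hτ_pos k).le)
      rw [Real.zero_rpow (hτ_pos k).ne'] at this
      exact this.eventually_lt_const hr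
  obtain ⟨m₀, hm₀⟩ := eventually_atTop.1 ((eventually_exists_well_distributed hω hv hτ_pos hτ_sum
    hθ hNv hr hx).and (hsmall.and ((htop.eventually hψ_le).and
      (((tendsto_add_atTop_nat 1).eventually hvreg).and (eventually_ge_atTop m)))))
  have hex : ∀ i, m₀ ≤ i → _ := fun i hi => (hm₀ i hi).1
  choose! G hG1 hG2 hG3 hG4 using hex
  set V : ℕ → ℝ := fun i => v (𝒩 (i + 1)) with hV
  set Ψ : ℕ → Fin n → ℝ := fun i k => ψ k (𝒩 (i + 1)) with hΨ
  have hVpos : ∀ i, 0 < V i := fun i => hv _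
  have hΨ0 : ∀ i k, 0 ≤ Ψ i k := fun i k => hψ_nonneg _ _ (hN1 _)
  have hΨanti : ∀ i l, i ≤ l → ∀ k, Ψ l k ≤ Ψ i k := fun i l hil k =>
    hψ_anti k (hN1 _) (hN1 _) (hω.index_strictMono.monotone (by omega))
  set φ : ℕ → ℝ := fun i => (V i)⁻¹ * ∏ k, Ψ i k with hφ
  have hφ0 : ∀ i, 0 ≤ φ i := fun i =>
    mul_nonneg (inv_nonneg.2 (hVpos i).le) (Finset.prod_nonneg fun k _ => hΨ0 i k)
  have hVgeom : ∀ i, m₀ ≤ i → ∀ d, V (i + d) ≤ θ ^ d * V i := by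
    intro i hi d
    induction d with
    | zero => simp
    | succ d ih =>
      have h1 : V (i + d + 1) ≤ θ * V (i + d) := (hm₀ (i + d) (by omega)).2.2.2.1
      calc V (i + (d + 1)) ≤ θ * V (i + d) := h1
        _ ≤ θ * (θ ^ d * V i) := by gcongr
        _ = _ := by ring
  -- Divergence enters here. A sum of at least `1` lets the linear term of the second moment be
  -- absorbed into the quadratic one, so `B` does not depend on the cube.
  obtain ⟨M, hM⟩ : ∃ M, 1 ≤ ∑ i ∈ Finset.Ico m₀ M, φ i := by
    by_contra! hcon
    refine hdiv ((summable_nat_add_iff (m₀ + 1)).1 (summable_of_sum_range_le (c := 1)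
      (fun i => hφ0 (i + m₀)) fun M => ?_))
    have h1 := (hcon (m₀ + M)).le
    rw [Finset.sum_Ico_eq_sum_range, Nat.add_sub_cancel_left] at h1
    exact (Finset.sum_congr rfl fun i _ => by
      simp only [hφ, hV, hΨ, show i + (m₀ + 1) = m₀ + i + 1 by omega]).trans_le h1
  set S : ℝ := ∑ i ∈ Finset.Ico m₀ M, φ i with hS
  set F : Finset (Σ _ : ℕ, ℕ) := (Finset.Ico m₀ M).sigma G with hF
  set E : (Σ _ : ℕ, ℕ) → Set (Fin n → ℝ) := fun a => openBox (ω a.2) (Ψ a.1) with hE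
  have hCE := sq_sum_measureReal_le volume F E (fun a => (isOpen_openBox _ _).measurableSet)
    fun a => volume_openBox_ne_top _ _
  have hfirst : (1 - θ) / 2 * (2 * r) ^ n * S ≤ ∑ a ∈ F, volume.real (E a) := by
    rw [hF, Finset.sum_sigma, hS, Finset.mul_sum]
    refine Finset.sum_le_sum fun i hi => ?_
    have hi' := (Finset.mem_Ico.1 hi).1
    have h1 : ∀ j ∈ G i, volume.real (E ⟨i, j⟩) = 2 ^ n * ∏ k, Ψ i k :=
      fun j _ => volume_real_openBox _ (hΨ0 i)
    rw [Finset.sum_congr rfl h1, Finset.sum_const, nsmul_eq_mul]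
    calc (1 - θ) / 2 * (2 * r) ^ n * φ i ≤ (G i).card * V i * φ i :=
          mul_le_mul_of_nonneg_right (hG2 i hi') (hφ0 i)
      _ = (G i).card * (1 * ∏ k, Ψ i k) := by
          have := (hVpos i).ne'
          simp only [hφ]
          field_simp
      _ ≤ _ := by
          have : 0 ≤ ∏ k, Ψ i k := Finset.prod_nonneg fun k _ => hΨ0 i k
          gcongr
          exact one_le_pow₀ one_le_two
  have hsecond : ∑ a ∈ F, ∑ b ∈ F, volume.real (E a ∩ E b) ≤
      12 ^ n * (2 * r) ^ n * (S ^ 2 + 2 / (1 - ρ) * S) := by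
    have h1 := sum_sum_le_sq_add
      (I := fun i l => ∑ j ∈ G i, ∑ j' ∈ G l,
        volume.real (openBox (ω j) (Ψ i) ∩ openBox (ω j') (Ψ l)))
      (fun i l => by
        rw [Finset.sum_comm]
        simp only [Set.inter_comm])
      (K := 12 ^ n * (2 * r) ^ n) (by positivity) hρ0 hρ1 hφ0 (Finset.Ico m₀ M)
      (fun i hi l hl hil => by
        have hi' := (Finset.mem_Ico.1 hi).1
        have hl' := (Finset.mem_Ico.1 hl).1
        refine sum_sum_volume_inter_le hτ_sum (hVpos i) (hVpos l) (hΨ0 l) (hΨanti i l hil)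
          (fun k => (hm₀ i hi').2.2.1 k) (hG3 i hi') (hG4 l hl') (by positivity)
          (pow_le_one₀ hρ0 hρ1.le) fun k => ?_
        have hVl : V l / V i ≤ θ ^ (l - i) := by
          rw [div_le_iff₀ (hVpos i)]
          simpa [Nat.add_sub_cancel' hil] using hVgeom i hi' (l - i)
        calc (V l / V i) ^ τ k ≤ (θ ^ (l - i)) ^ τ k :=
              Real.rpow_le_rpow (div_pos (hVpos l) (hVpos i)).le hVl (hτ_pos k).le
          _ = (θ ^ τ k) ^ (l - i) := by
              rw [← Real.rpow_natCast, ← Real.rpow_natCast, ← Real.rpow_mul hθ0.le,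
                ← Real.rpow_mul hθ0.le, mul_comm]
          _ ≤ ρ ^ (l - i) := pow_le_pow_left₀ (Real.rpow_nonneg hθ0.le _) (hρ k) _)
    refine le_trans (le_of_eq ?_) h1
    rw [hF, Finset.sum_sigma]
    refine Finset.sum_congr rfl fun i _ => ?_
    rw [Finset.sum_comm]
    rw [Finset.sum_sigma]
    refine Finset.sum_congr rfl fun l _ => ?_
    exact Finset.sum_comm
  have hsub : (⋃ a ∈ F, E a) ⊆ tailSet ω ψ m ∩ Metric.closedBall x (2 * r) := by
    intro y hy
    obtain ⟨⟨i, j⟩, ha, hy⟩ := Set.mem_iUnion₂.1 hy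
    obtain ⟨hi, hj⟩ := Finset.mem_sigma.1 ha
    have hi' := (Finset.mem_Ico.1 hi).1
    obtain ⟨hj1, hj2, hj3⟩ := hG1 i hi' j hj
    have him : m ≤ i := (hm₀ i hi').2.2.2.2
    have hNi : i ≤ 𝒩 i := hω.index_strictMono.id_le i
    have hj0 : 1 ≤ j := by omega
    -- As `j ≤ 𝒩 (i + 1)` and `ψ k` is non-increasing, the chosen box lies in the true `j`-th box;
    -- `m ≤ i ≤ 𝒩 i < j` puts it in the tail.
    refine ⟨⟨j, by omega, hj0, fun k => (hy k).trans_le (hψ_anti k hj0 (hN1 _) hj2)⟩, ?_⟩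
    rw [Metric.mem_closedBall, dist_pi_le_iff (by linarith)]
    intro k
    have e1 : |y k - ω j k| < Ψ i k := hy k
    have e2 := (hm₀ i hi').2.2.1 k
    have e3 := (hm₀ i hi').2.1 k
    have e4 := abs_sub_le (y k) (ω j k) (x k)
    have e5 := hj3 k
    change Ψ i k ≤ _ at e2
    rw [Real.dist_eq]
    linarith
  have hmono : volume.real (⋃ a ∈ F, E a) ≤
      volume.real (tailSet ω ψ m ∩ Metric.closedBall x (2 * r)) :=
    measureReal_mono hsub (measure_ne_top_of_subset Set.inter_subset_right
      (isCompact_closedBall x (2 * r)).measure_ne_top)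
  set L : ℝ := (2 * r) ^ n with hL
  have hLpos : 0 < L := by positivity
  set u := volume.real (⋃ a ∈ F, E a) with hu
  have hu0 : 0 ≤ u := measureReal_nonneg
  refine le_trans ?_ hmono
  have hSpos : 0 < S := by linarith
  have hS2 : S ^ 2 + 2 / (1 - ρ) * S ≤ B * S ^ 2 := by
    have : 0 ≤ 2 / (1 - ρ) := div_nonneg zero_le_two (by linarith)
    have : 2 / (1 - ρ) * S ≤ 2 / (1 - ρ) * S ^ 2 := by
      gcongr
      nlinarith
    rw [hB]
    linarith
  have hchain : ((1 - θ) / 2 * L * S) ^ 2 ≤ u * (12 ^ n * L * (B * S ^ 2)) :=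
    calc ((1 - θ) / 2 * L * S) ^ 2 ≤ (∑ a ∈ F, volume.real (E a)) ^ 2 :=
          pow_le_pow_left₀ (by positivity) hfirst 2
      _ ≤ _ := hCE
      _ ≤ u * (12 ^ n * L * (S ^ 2 + 2 / (1 - ρ) * S)) := by gcongr
      _ ≤ _ := by gcongr
  rw [div_mul_eq_mul_div, div_le_iff₀ (by positivity)]
  have hLS : 0 < L * S ^ 2 := by positivity
  refine le_of_mul_le_mul_right ?_ hLS
  linarith

/-! ### From local density to full measure -/

theorem mainTheorem1 {n : ℕ} (𝒩 : ℕ → ℕ) (v : ℕ → ℝ) (ω : ℕ → Fin n → ℝ)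
    (ψ : Fin n → ℕ → ℝ) (τ : Fin n → ℝ) (c : ℝ)
    (hω : IsDiscrepancySatisfying 𝒩 v ω)
    (hψ_nonneg : ∀ i N, 1 ≤ N → 0 ≤ ψ i N)
    (hψ_anti : ∀ i, AntitoneOn (ψ i) (Set.Ici 1))
    (hreg : (∀ i, IsRegularAlong c 𝒩 (ψ i)) ∨ IsRegularAlong c 𝒩 v)
    (hτ_pos : ∀ i, 0 < τ i) (hτ_sum : ∑ i, τ i = 1)
    (hψ_le : ∀ᶠ N in atTop, ∀ i, ψ i N ≤ v N ^ τ i)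
    (hdiv : ¬ Summable (fun j : ℕ => (v (𝒩 j))⁻¹ * ∏ i, ψ i (𝒩 j))) :
    volume (approxSet ω ψ) = 1 := by
  have hne : Nonempty (Fin n) := by
    by_contra h
    rw [not_nonempty_iff] at h
    simp at hτ_sum
  have hinv : ∀ i, ((𝒩 i : ℝ))⁻¹ < v (𝒩 i) := fun i =>
    (inv_le_discrepancy (hω.index_pos i) fun j hj k => (hω.mem_cube j hj k).1).trans_lt
      (hω.discrepancy_lt i)
  have hNpos : ∀ i, (0 : ℝ) < 𝒩 i := fun i => by exact_mod_cast hω.index_pos i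
  have hv : ∀ i, 0 < v (𝒩 i) := fun i => (inv_pos.2 (hNpos i)).trans (hinv i)
  obtain ⟨θ, hθ0, hθ1, hNv⟩ : ∃ θ : ℝ, 0 < θ ∧ θ < 1 ∧
      ∀ᶠ i in atTop, 𝒩 i * v (𝒩 (i + 1)) ≤ θ := by
    -- Positivity of the terms keeps `e` above `0`, so it is a real number and can serve as `θ`.
    obtain ⟨e, he1, he2⟩ := exists_between hω.limsup_lt
    have hev := eventually_lt_of_limsup_lt he1
    have hpos : ∃ i, (((𝒩 i : ℝ) * v (𝒩 (i + 1)) : ℝ) : EReal) < e := hev.exists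
    obtain ⟨i, hi⟩ := hpos
    have he0 : (0 : EReal) < e := lt_trans
      (by exact_mod_cast mul_pos (hNpos i) (hv (i + 1))) hi
    lift e to ℝ using ⟨(he2.trans (by exact_mod_cast EReal.coe_lt_top 1)).ne,
      ((EReal.bot_lt_coe 0).trans he0).ne'⟩
    refine ⟨e, by exact_mod_cast he0, by exact_mod_cast he2, ?_⟩
    filter_upwards [hev] with i hi
    exact_mod_cast hi.le
  -- Geometric decay of `v` results from `𝒩 i * v (𝒩 (i + 1)) ≤ θ` and `1 / 𝒩 i < v (𝒩 i)`.
  have hvreg : ∀ᶠ i in atTop, v (𝒩 (i + 1)) ≤ θ * v (𝒩 i) := by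
    filter_upwards [hNv] with i hi
    have h1 : v (𝒩 (i + 1)) ≤ θ * (𝒩 i : ℝ)⁻¹ := by
      rw [← div_eq_mul_inv, le_div_iff₀ (hNpos i), mul_comm]
      exact hi
    exact h1.trans (mul_le_mul_of_nonneg_left (hinv i).le hθ0.le)
  obtain ⟨κ, hκ, hdens⟩ := exists_le_volume_tailSet_inter hω hψ_nonneg hψ_anti hτ_pos hτ_sum
    hψ_le hdiv hv hθ0 hθ1 hNv hvreg
  set O : Set (Fin n → ℝ) := Set.pi Set.univ fun _ => Set.Ioo 0 1 with hO
  have hnull : ∀ m, volume (O \ tailSet ω ψ m) = 0 := by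
    intro m
    refine measure_diff_eq_zero_of_density volume (isOpen_tailSet ω ψ m).measurableSet
      (isOpen_set_pi Set.finite_univ fun _ _ => isOpen_Ioo).measurableSet
      (κ := κ / 2 ^ n) (by positivity) fun x hx => ?_
    have hball : ∀ᶠ r in 𝓝[>] (0 : ℝ), ∀ k, 0 ≤ x k - r ∧ x k + r ≤ 1 :=
      eventually_all.2 fun k => by
        have hk := hx k (Set.mem_univ k)
        filter_upwards [Ioo_mem_nhdsGT (lt_min hk.1 (sub_pos.2 hk.2))] with r hr
        have h1 := hr.2.trans_le (min_le_left _ _)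
        have h2 := hr.2.trans_le (min_le_right _ _)
        constructor <;> linarith
    filter_upwards [hball, self_mem_nhdsWithin] with r hr hr0
    have hr0' : (0 : ℝ) < r := hr0
    -- The boxes may stick out of the cube of their centres, so the density bound concerns a ball of
    -- twice the radius; halving `r` costs the factor `2 ^ n` in `κ`.
    have h1 := hdens x (r / 2) (by linarith)
      (fun k => ⟨by linarith [hr k], by linarith [hr k]⟩) m
    have h2 : 2 * (r / 2) = r := by ring
    rw [h2] at h1
    have h3 : volume.real (Metric.closedBall x r) = 2 ^ n * r ^ n := by
      rw [Measure.real, Real.volume_pi_closedBall x hr0'.le, ENNReal.toReal_ofReal (by positivity)]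
      simp [mul_pow]
    rw [h3]
    refine le_trans (le_of_eq ?_) h1
    field_simp
  have hIcc : volume (Set.Icc (0 : Fin n → ℝ) 1) = 1 := by simp [Real.volume_Icc_pi]
  refine le_antisymm ?_ ?_
  · rw [approxSet_eq, ← hIcc]
    exact measure_mono Set.inter_subset_left
  · have hOvol : volume O = 1 := by simp [hO, Real.volume_pi_Ioo]
    rw [← hOvol]
    refine (measure_mono (t := approxSet ω ψ ∪ ⋃ m, O \ tailSet ω ψ m) fun y hy => ?_).trans
      ((measure_union_le _ _).trans_eq ?_)
    · by_cases h : ∀ m, y ∈ tailSet ω ψ m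
      · left
        rw [approxSet_eq]
        exact ⟨⟨fun k => (hy k (Set.mem_univ k)).1.le, fun k => (hy k (Set.mem_univ k)).2.le⟩,
          Set.mem_iInter.2 h⟩
      · right
        obtain ⟨m, hm⟩ := not_forall.1 h
        exact Set.mem_iUnion.2 ⟨m, hy, hm⟩
    · rw [measure_iUnion_null hnull, add_zero]
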